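/- Let $H$ and $K$ be complex Hilbert spaces, and let $\Phi:\mathcal B(H)\to\mathcal B(K)$ be a unital positive linear map between the algebras of all bounded operators. For a positive invertible operator $A\in\mathcal B(H)$ define the operator valued determinant $\Delta_\Phi(A)=\exp\Phi(\log A)$. For $h>0$ let $$S(h)=\frac{(h-1)\,h^{\frac1{h-1}}}{e\log h}\quad(h\neq 1),\qquad S(1)=1$$ be the Specht ratio, and for $q\in\mathbb R$ let $$K(h,q)=\frac{h^q-h}{(q-1)(h-1)}\left(\frac{q-1}{q}\cdot\frac{h^q-1}{h^q-h}\right)^q$$ be the generalized Kantorovich constant, with $K(h,0)=K(h,1)=K(1,q)=1$ (the limit values). Let $A,B\in\mathcal B(H)$ be positive invertible operators such that $mI\le A\le MI$ and $mI\le B\le MI$ for some scalars $0<m<M$, and put $h=M/m$. Then for every real $p\ge 1$ $$2^{1-\frac1p}\,S\big(h^{\frac1p}\big)^{-3}\,K\big(h,\tfrac1p\big)\,\Delta_\Phi(A+B)^{\frac1p}\;\le\;\Delta_\Phi(A)^{\frac1p}+\Delta_\Phi(B)^{\frac1p}\;\le\;2^{1-\frac1p}\,S\big(h^{\frac1p}\big)^{3}\,\Delta_\Phi(A+B)^{\frac1p}$$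 in the Löwner order of $\mathcal B(K)$. -/

import Mathlib

noncomputable section

/-- The Specht ratio `S(h) = (h - 1) h^{1/(h-1)} / (e log h)` for `h ≠ 1`, and `S(1) = 1`. -/
def spechtRatio (h : ℝ) : ℝ :=
  if h = 1 then 1
  else (h - 1) * h ^ (1 / (h - 1)) / (Real.exp 1 * Real.log h)

/-- The generalized Kantorovich constant
`K(h,p) = (h^p - h) / ((p-1)(h-1)) * ((p-1)/p * (h^p-1)/(h^p-h))^p`. At the removable
singularities `h = 1`, `p = 0`, `p = 1` the expression is read as its limit, which is `1`. -/
def kantorovichConst (h p : ℝ) : ℝ :=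
  if h = 1 ∨ p = 0 ∨ p = 1 then 1
  else (h ^ p - h) / ((p - 1) * (h - 1)) * ((p - 1) / p * ((h ^ p - 1) / (h ^ p - h))) ^ p

/-- The operator valued determinant `Δ_Φ(A) = exp Φ(log A)` of a positive linear map
`Φ : B(H) → B(K)`; here `log` is taken in the continuous functional calculus and `exp` is the
exponential of the Banach algebra `B(K)`. -/
def operatorDet {H K : Type*}
    [NormedAddCommGroup H] [InnerProductSpace ℂ H] [CompleteSpace H]
    [NormedAddCommGroup K] [InnerProductSpace ℂ K] [CompleteSpace K]
    (Φ : (H →L[ℂ] H) →ₚ[ℂ] (K →L[ℂ] K)) (A : H →L[ℂ] H) : K →L[ℂ] K :=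
  NormedSpace.exp (Φ (CFC.log A))

end

/-! A unital linear map commutes with affine functions, so replacing `exp (q * u)` by its chord lets
`Φ` pass through the functional calculus of `log a`. Chord and exponential differ by at most the
factor `S(h^q)`, hence so do `Φ (a ^ q)` and `exp (Φ (log a)) ^ q` (`map_rpow_specht_exp_map_log`).

With `q = 1/p` this reduces the theorem to comparing `A ^ q + B ^ q` with `(A + B) ^ q`: operator
concavity of `t ^ q` gives the upper bound (`rpow_add_rpow_le`), and a chord argument gives its
reverse with the Kantorovich constant (`kantorovichConst_smul_add_rpow_le`). -/

/-- On `[log m, log M]` the exponential lies below its chord, and the chord lies below the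
exponential multiplied by the Specht ratio of `M / m`. -/
theorem exists_chord_exp_specht {m M : ℝ} (hm : 0 < m) (hmM : m < M) :
    ∃ a b : ℝ, ∀ u ∈ Set.Icc (Real.log m) (Real.log M),
      Real.exp u ≤ a * u + b ∧ a * u + b ≤ spechtRatio (M / m) * Real.exp u := by
  have hM : 0 < M := hm.trans hmM
  have hlog : 0 < Real.log M - Real.log m := sub_pos.2 (Real.log_lt_log hm hmM)
  set a : ℝ := (M - m) / (Real.log M - Real.log m) with ha
  set b : ℝ := m - a * Real.log m with hb
  have ha0 : 0 < a := div_pos (sub_pos.2 hmM) hlog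
  have haM : a * (Real.log M - Real.log m) = M - m := div_mul_cancel₀ _ hlog.ne'
  -- This is the maximum of `(a * u + b) * exp (-u)`, attained at `u = 1 - b / a`.
  have hS : spechtRatio (M / m) = a * Real.exp (b / a - 1) := by
    have h1 : M / m ≠ 1 := fun h => hmM.ne' ((div_eq_one_iff_eq hm.ne').1 h)
    have hMm : M - m ≠ 0 := (sub_pos.2 hmM).ne'
    have e : M / m - 1 = (M - m) / m := by field_simp
    have eb : b / a - 1 = (Real.log M - Real.log m) * (1 / ((M - m) / m)) - Real.log m - 1 := by
      rw [hb, ha]; field_simp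
    rw [spechtRatio, if_neg h1, Real.rpow_def_of_pos (div_pos hM hm),
      Real.log_div hM.ne' hm.ne', eb, Real.exp_sub, Real.exp_sub, Real.exp_log hm, e, ha]
    field_simp
  refine ⟨a, b, fun u hu => ⟨?_, ?_⟩⟩
  · set t : ℝ := (u - Real.log m) / (Real.log M - Real.log m) with ht
    have htu : t * (Real.log M - Real.log m) = u - Real.log m := div_mul_cancel₀ _ hlog.ne'
    have ht0 : 0 ≤ t := div_nonneg (sub_nonneg.2 hu.1) hlog.le
    have ht1 : 0 ≤ 1 - t := sub_nonneg.2 ((div_le_one hlog).2 (by linarith [hu.2]))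
    have key := convexOn_exp.2 (Set.mem_univ (Real.log m)) (Set.mem_univ (Real.log M))
      ht1 ht0 (by ring)
    simp only [smul_eq_mul, Real.exp_log hm, Real.exp_log hM] at key
    have e1 : (1 - t) * Real.log m + t * Real.log M = u := by linear_combination htu
    have e2 : (1 - t) * m + t * M = a * u + b := by
      rw [hb]; linear_combination a * htu - t * haM
    rwa [e1, e2] at key
  · rw [hS, mul_assoc, ← Real.exp_add]
    have key := Real.add_one_le_exp (b / a - 1 + u)
    have e : a * u + b = a * (b / a - 1 + u + 1) := by field_simp; ring
    rw [e]
    exact mul_le_mul_of_nonneg_left key ha0.le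

theorem one_le_spechtRatio {m M : ℝ} (hm : 0 < m) (hmM : m < M) : 1 ≤ spechtRatio (M / m) := by
  obtain ⟨a, b, hab⟩ := exists_chord_exp_specht hm hmM
  obtain ⟨h1, h2⟩ := hab _ ⟨le_rfl, Real.log_le_log hm hmM.le⟩
  exact le_of_mul_le_mul_right (by simpa using h1.trans h2) (Real.exp_pos (Real.log m))

/-- For `0 < q < 1`, on `[m, M]` the power `t ^ q` lies above its chord, and the chord lies above
the power multiplied by the generalized Kantorovich constant of `M / m`. -/
theorem exists_chord_rpow_kantorovich {m M q : ℝ} (hm : 0 < m) (hmM : m < M) (hq0 : 0 < q)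
    (hq1 : q < 1) :
    ∃ a b : ℝ, ∀ t ∈ Set.Icc m M,
      a * t + b ≤ t ^ q ∧ kantorovichConst (M / m) q * t ^ q ≤ a * t + b := by
  have hM : 0 < M := hm.trans hmM
  have hMm : 0 < M - m := sub_pos.2 hmM
  set x : ℝ := m ^ q with hx
  set y : ℝ := M ^ q with hy
  have hx0 : 0 < x := Real.rpow_pos_of_pos hm q
  have hxy : x < y := Real.rpow_lt_rpow hm.le hmM hq0
  -- The chord has positive intercept because `t ^ q / t` decreases; AM-GM below needs this.
  have hyx : 0 < M * x - m * y := by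
    have h1 : 1 < M / m := (one_lt_div hm).2 hmM
    have h2 : (M / m) ^ q < M / m := by
      simpa using Real.rpow_lt_rpow_of_exponent_lt h1 hq1
    rw [Real.div_rpow hM.le hm.le, div_lt_div_iff₀ hx0 hm] at h2
    linarith
  set a : ℝ := (y - x) / (M - m) with ha
  set b : ℝ := (M * x - m * y) / (M - m) with hb
  have ha0 : 0 < a := div_pos (sub_pos.2 hxy) hMm
  have hb0 : 0 < b := div_pos hyx hMm
  have hq1' : 0 < 1 - q := sub_pos.2 hq1
  -- The right side is the minimum of `(a * t + b) / t ^ q` over `t > 0`, as weighted AM-GM with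
  -- weights `q` and `1 - q` shows.
  have hK : kantorovichConst (M / m) q = (a / q) ^ q * (b / (1 - q)) ^ (1 - q) := by
    have h1 : M / m ≠ 1 := fun h => hmM.ne' ((div_eq_one_iff_eq hm.ne').1 h)
    have d1 : M / m - 1 = (M - m) / m := by field_simp
    have d2 : (M / m) ^ q - M / m = -((M * x - m * y) / (x * m)) := by
      rw [Real.div_rpow hM.le hm.le]; field_simp; ring
    have d3 : (M / m) ^ q - 1 = (y - x) / x := by
      rw [Real.div_rpow hM.le hm.le, ← hx, ← hy]; field_simp
    have e1 : ((M / m) ^ q - M / m) / ((q - 1) * (M / m - 1)) = b / (1 - q) / x := by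
      rw [d1, d2, hb, ← neg_sub 1 q]; field_simp
    have e2 : (q - 1) / q * (((M / m) ^ q - 1) / ((M / m) ^ q - M / m))
        = a / q / (b / (1 - q)) * m := by
      rw [d2, d3, ha, hb, ← neg_sub 1 q]; field_simp
    rw [kantorovichConst, if_neg (by simp [h1, hq0.ne', hq1.ne]), e1, e2,
      Real.mul_rpow (by positivity) hm.le, Real.div_rpow (by positivity) (by positivity),
      Real.rpow_sub (by positivity), Real.rpow_one, ← hx]
    field_simp
  refine ⟨a, b, fun t ht => ⟨?_, ?_⟩⟩
  · set s : ℝ := (t - m) / (M - m) with hs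
    have hst : s * (M - m) = t - m := div_mul_cancel₀ _ hMm.ne'
    have hs0 : 0 ≤ s := div_nonneg (sub_nonneg.2 ht.1) hMm.le
    have hs1 : 0 ≤ 1 - s := sub_nonneg.2 ((div_le_one hMm).2 (by linarith [ht.2]))
    have key := (Real.concaveOn_rpow hq0.le hq1.le).2 hm.le hM.le hs1 hs0 (by ring)
    simp only [smul_eq_mul] at key
    have e1 : (1 - s) * m + s * M = t := by linear_combination hst
    have e2 : (1 - s) * m ^ q + s * M ^ q = a * t + b := by
      rw [ha, hb, ← hx, ← hy, hs]; field_simp; ring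
    rwa [e1, e2] at key
  · have ht0 : 0 < t := hm.trans_le ht.1
    have key := Real.geom_mean_le_arith_mean2_weighted hq0.le hq1'.le
      (p₁ := a / q * t) (p₂ := b / (1 - q)) (by positivity) (by positivity) (by ring)
    rw [Real.mul_rpow (by positivity) ht0.le] at key
    have e : q * (a / q * t) + (1 - q) * (b / (1 - q)) = a * t + b := by field_simp
    rw [hK]
    linarith

theorem kantorovichConst_nonneg {h q : ℝ} (hh : 1 < h) (hq0 : 0 < q) (hq1 : q ≤ 1) :
    0 ≤ kantorovichConst h q := by
  rw [kantorovichConst]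
  split_ifs with hc
  · exact zero_le_one
  · push Not at hc
    have hq : q < 1 := lt_of_le_of_ne hq1 hc.2.2
    have h1 : 1 ≤ h ^ q := Real.one_le_rpow hh.le hq0.le
    have h2 : h ^ q ≤ h := by simpa using Real.rpow_le_rpow_of_exponent_le hh.le hq1
    refine mul_nonneg (div_nonneg_of_nonpos (by linarith)
      (mul_nonpos_of_nonpos_of_nonneg (by linarith) (by linarith))) (Real.rpow_nonneg ?_ _)
    exact mul_nonneg_of_nonpos_of_nonpos (div_nonpos_of_nonpos_of_nonneg (by linarith) hq0.le)
      (div_nonpos_of_nonneg_of_nonpos (by linarith) (by linarith))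

theorem continuousOn_log_of_subset_Icc {m M : ℝ} (hm : 0 < m) {s : Set ℝ}
    (hs : s ⊆ Set.Icc m M) : ContinuousOn Real.log s :=
  Real.continuousOn_log.mono fun _ hx => (hm.trans_le (hs hx).1).ne'

section CStarAlgebra

variable {𝒜 ℬ : Type*} [CStarAlgebra 𝒜] [CStarAlgebra ℬ]

theorem cfc_mul_add_const (f : ℝ → ℝ) (c d : ℝ) {a : 𝒜} (ha : IsSelfAdjoint a)
    (hf : ContinuousOn f (spectrum ℝ a)) :
    cfc (fun x => c * f x + d) a = c • cfc f a + d • 1 := by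
  rw [cfc_add_const d (fun x => c * f x) a (by fun_prop) ha, cfc_const_mul c f a hf,
    Algebra.algebraMap_eq_smul_one]

variable [PartialOrder 𝒜] [StarOrderedRing 𝒜] [PartialOrder ℬ] [StarOrderedRing ℬ]

theorem isSelfAdjoint_of_smul_one_le {r : ℝ} {a : 𝒜} (h : r • (1 : 𝒜) ≤ a) :
    IsSelfAdjoint a := by
  simpa using (IsSelfAdjoint.of_nonneg (sub_nonneg.2 h)).add
    ((IsSelfAdjoint.all r).smul (IsSelfAdjoint.one 𝒜))

theorem spectrum_subset_Icc_of_smul_one_le {r s : ℝ} {a : 𝒜} (hr : r • (1 : 𝒜) ≤ a)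
    (hs : a ≤ s • (1 : 𝒜)) : spectrum ℝ a ⊆ Set.Icc r s := by
  have ha := isSelfAdjoint_of_smul_one_le hr
  rw [← Algebra.algebraMap_eq_smul_one] at hr hs
  exact fun x hx => ⟨(algebraMap_le_iff_le_spectrum ha).1 hr x hx,
    (le_algebraMap_iff_spectrum_le ha).1 hs x hx⟩

theorem log_mem_Icc_smul_one {m M : ℝ} (hm : 0 < m) {a : 𝒜} (hma : m • (1 : 𝒜) ≤ a)
    (haM : a ≤ M • (1 : 𝒜)) :
    Real.log m • (1 : 𝒜) ≤ CFC.log a ∧ CFC.log a ≤ Real.log M • (1 : 𝒜) := by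
  have ha := isSelfAdjoint_of_smul_one_le hma
  have hsp := spectrum_subset_Icc_of_smul_one_le hma haM
  have hc := continuousOn_log_of_subset_Icc hm hsp
  rw [← Algebra.algebraMap_eq_smul_one, ← Algebra.algebraMap_eq_smul_one, CFC.log]
  exact ⟨algebraMap_le_cfc _ _ _ (fun x hx => Real.log_le_log hm (hsp hx).1) hc ha,
    cfc_le_algebraMap _ _ _
      (fun x hx => Real.log_le_log (hm.trans_le (hsp hx).1) (hsp hx).2) hc ha⟩

theorem exp_rpow_eq_cfc {a : 𝒜} (ha : IsSelfAdjoint a) (q : ℝ) :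
    NormedSpace.exp a ^ q = cfc (fun x : ℝ => Real.exp (q * x)) a := by
  rw [← CFC.real_exp_eq_normedSpace_exp ha, CFC.cfc_rpow fun x _ => Real.exp_pos x]
  exact cfc_congr fun x _ => by rw [← Real.exp_mul, mul_comm]

/-- For a unital positive linear map `Φ` and `m ≤ a ≤ M`, the elements `Φ (a ^ q)` and
`(exp (Φ (log a))) ^ q` dominate each other up to the Specht ratio of `(M / m) ^ q`. -/
theorem map_rpow_specht_exp_map_log (Φ : 𝒜 →ₚ[ℂ] ℬ) (hΦ : Φ 1 = 1) {m M q : ℝ} (hm : 0 < m)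
    (hmM : m < M) (hq : 0 < q) {a : 𝒜} (hma : m • (1 : 𝒜) ≤ a) (haM : a ≤ M • (1 : 𝒜)) :
    Φ (a ^ q) ≤ spechtRatio ((M / m) ^ q) • NormedSpace.exp (Φ (CFC.log a)) ^ q ∧
      NormedSpace.exp (Φ (CFC.log a)) ^ q ≤ spechtRatio ((M / m) ^ q) • Φ (a ^ q) := by
  have hM : 0 < M := hm.trans hmM
  have hΦs : ∀ (r : ℝ) (x : 𝒜), Φ (r • x) = r • Φ x := fun r x => Φ.map_smul_of_tower r x
  obtain ⟨c, d, hcd⟩ := exists_chord_exp_specht (Real.rpow_pos_of_pos hm q)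
    (Real.rpow_lt_rpow hm.le hmM hq)
  rw [← Real.div_rpow hM.le hm.le, Real.log_rpow hm, Real.log_rpow hM] at hcd
  set S := spechtRatio ((M / m) ^ q)
  have chord : ∀ u ∈ Set.Icc (Real.log m) (Real.log M),
      Real.exp (q * u) ≤ c * q * u + d ∧ c * q * u + d ≤ S * Real.exp (q * u) := fun u hu => by
    simpa [mul_assoc] using hcd (q * u)
      ⟨mul_le_mul_of_nonneg_left hu.1 hq.le, mul_le_mul_of_nonneg_left hu.2 hq.le⟩
  have ha := isSelfAdjoint_of_smul_one_le hma
  have hsp := spectrum_subset_Icc_of_smul_one_le hma haM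
  have hlog := continuousOn_log_of_subset_Icc hm hsp
  have ha0 : 0 ≤ a := (smul_nonneg hm.le zero_le_one).trans hma
  obtain ⟨hl, hu⟩ := log_mem_Icc_smul_one hm hma haM
  have hXl := OrderHomClass.mono Φ hl
  have hXu := OrderHomClass.mono Φ hu
  simp only [hΦs, hΦ] at hXl hXu
  set X := Φ (CFC.log a)
  have hX := isSelfAdjoint_of_smul_one_le hXl
  have hspX := spectrum_subset_Icc_of_smul_one_le hXl hXu
  have hpow : ContinuousOn (fun t : ℝ => t ^ q) (spectrum ℝ a) :=
    (Real.continuous_rpow_const hq.le).continuousOn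
  have chord' : ∀ t ∈ spectrum ℝ a,
      t ^ q ≤ c * q * Real.log t + d ∧ c * q * Real.log t + d ≤ S * t ^ q := fun t ht => by
    have ht0 : 0 < t := hm.trans_le (hsp ht).1
    have := chord (Real.log t)
      ⟨Real.log_le_log hm (hsp ht).1, Real.log_le_log ht0 (hsp ht).2⟩
    rwa [mul_comm q, ← Real.rpow_def_of_pos ht0] at this
  -- The only place where `Φ` crosses the functional calculus; it works because the function is
  -- affine in `log t` and `Φ` is unital.
  have hmid : Φ (cfc (fun t : ℝ => c * q * Real.log t + d) a)
      = cfc (fun u : ℝ => c * q * u + d) X := by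
    rw [cfc_mul_add_const Real.log _ _ ha hlog,
      cfc_mul_add_const (fun u => u) _ _ hX continuousOn_id, cfc_id' ℝ X, map_add, hΦs, hΦs, hΦ]
    rfl
  rw [exp_rpow_eq_cfc hX, CFC.rpow_eq_cfc_real ha0]
  constructor
  · refine (OrderHomClass.mono Φ (cfc_mono (fun t ht => (chord' t ht).1) hpow
      (by fun_prop))).trans ?_
    rw [hmid, ← cfc_smul S _ X (by fun_prop)]
    exact cfc_mono fun u hu => (chord u (hspX hu)).2
  · refine (cfc_mono (g := fun u : ℝ => c * q * u + d)
      fun u hu => (chord u (hspX hu)).1).trans ?_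
    rw [← hmid, ← hΦs, ← cfc_smul S _ a hpow]
    exact OrderHomClass.mono Φ (cfc_mono (fun t ht => (chord' t ht).2) (by fun_prop)
      (hpow.const_smul S))

/-- Homogeneity of `t ^ q`: it turns midpoint inequalities into inequalities for sums and produces
the factor `2 ^ (1 - q)`. -/
theorem smul_half_add_rpow {a b : 𝒜} (ha : 0 ≤ a) (hb : 0 ≤ b) {q : ℝ} (hq : 0 ≤ q) :
    (2 : ℝ) • (((1 / 2 : ℝ) • (a + b)) ^ q) = (2 : ℝ) ^ (1 - q) • (a + b) ^ q := by
  have hab := add_nonneg ha hb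
  have hpow : ContinuousOn (fun t : ℝ => t ^ q) (spectrum ℝ (a + b)) :=
    (Real.continuous_rpow_const hq).continuousOn
  have hsa : IsSelfAdjoint (a + b) := .of_nonneg hab
  have h1 : ((1 / 2 : ℝ) • (a + b)) = cfc (fun t : ℝ => (1 / 2 : ℝ) * t) (a + b) := by
    rw [cfc_const_mul_id (1 / 2 : ℝ) (a + b) hsa]
  have h2 : ((1 / 2 : ℝ) • (a + b)) ^ q = (1 / 2 : ℝ) ^ q • (a + b) ^ q := by
    rw [CFC.rpow_eq_cfc_real (smul_nonneg (by norm_num) hab), h1,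
      ← cfc_comp' (fun t : ℝ => t ^ q) (fun t : ℝ => (1 / 2 : ℝ) * t) (a + b)
        (Real.continuous_rpow_const hq).continuousOn (by fun_prop) hsa,
      CFC.rpow_eq_cfc_real hab, ← cfc_smul _ _ _ hpow]
    refine cfc_congr fun t ht => ?_
    exact Real.mul_rpow (by norm_num) (spectrum_nonneg_of_nonneg hab ht)
  rw [h2, smul_smul, Real.rpow_sub two_pos, Real.rpow_one, one_div,
    Real.inv_rpow two_pos.le, div_eq_mul_inv]

theorem rpow_add_rpow_le {a b : 𝒜} (ha : 0 ≤ a) (hb : 0 ≤ b) {q : ℝ} (hq : q ∈ Set.Icc 0 1) :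
    a ^ q + b ^ q ≤ (2 : ℝ) ^ (1 - q) • (a + b) ^ q := by
  have key := (CFC.concaveOn_rpow (A := 𝒜) hq).2 ha hb (one_half_pos (α := ℝ)).le
    (one_half_pos (α := ℝ)).le (add_halves 1)
  simp only [← smul_add] at key
  have := smul_le_smul_of_nonneg_left key (zero_le_two (α := ℝ))
  rwa [smul_half_add_rpow ha hb hq.1, smul_smul, mul_one_div_cancel two_ne_zero, one_smul] at this

/-- A reverse of the operator concavity of `t ^ q` at the midpoint, with the generalized
Kantorovich constant. -/
theorem kantorovichConst_smul_add_rpow_le {m M q : ℝ} (hm : 0 < m) (hmM : m < M) (hq0 : 0 < q)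
    (hq1 : q ≤ 1) {a b : 𝒜} (hma : m • (1 : 𝒜) ≤ a) (haM : a ≤ M • (1 : 𝒜))
    (hmb : m • (1 : 𝒜) ≤ b) (hbM : b ≤ M • (1 : 𝒜)) :
    ((2 : ℝ) ^ (1 - q) * kantorovichConst (M / m) q) • (a + b) ^ q ≤ a ^ q + b ^ q := by
  have ha0 : 0 ≤ a := (smul_nonneg hm.le zero_le_one).trans hma
  have hb0 : 0 ≤ b := (smul_nonneg hm.le zero_le_one).trans hmb
  rcases hq1.eq_or_lt with rfl | hq1
  · simp [kantorovichConst, CFC.rpow_one _ ha0, CFC.rpow_one _ hb0,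
      CFC.rpow_one _ (add_nonneg ha0 hb0)]
  obtain ⟨c, d, hcd⟩ := exists_chord_rpow_kantorovich hm hmM hq0 hq1
  have hcont : ∀ s : Set ℝ, ContinuousOn (fun t : ℝ => t ^ q) s := fun _ =>
    (Real.continuous_rpow_const hq0.le).continuousOn
  have affine : ∀ x : 𝒜, IsSelfAdjoint x →
      cfc (fun t : ℝ => c * t + d) x = c • x + d • 1 := fun x hx => by
    rw [cfc_mul_add_const (fun t => t) _ _ hx continuousOn_id, cfc_id' ℝ x]
  have lower : ∀ x : 𝒜, m • (1 : 𝒜) ≤ x → x ≤ M • (1 : 𝒜) → c • x + d • 1 ≤ x ^ q := by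
    intro x hmx hxM
    have hsp := spectrum_subset_Icc_of_smul_one_le hmx hxM
    rw [← affine x (isSelfAdjoint_of_smul_one_le hmx),
      CFC.rpow_eq_cfc_real ((smul_nonneg hm.le zero_le_one).trans hmx)]
    exact cfc_mono (fun t ht => (hcd t (hsp ht)).1) (by fun_prop) (hcont _)
  have upper : ∀ x : 𝒜, m • (1 : 𝒜) ≤ x → x ≤ M • (1 : 𝒜) →
      kantorovichConst (M / m) q • x ^ q ≤ c • x + d • 1 := by
    intro x hmx hxM
    have hsp := spectrum_subset_Icc_of_smul_one_le hmx hxM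
    rw [← affine x (isSelfAdjoint_of_smul_one_le hmx),
      CFC.rpow_eq_cfc_real ((smul_nonneg hm.le zero_le_one).trans hmx),
      ← cfc_smul _ _ _ (hcont _)]
    exact cfc_mono (fun t ht => (hcd t (hsp ht)).2) ((hcont (spectrum ℝ x)).const_smul (kantorovichConst (M / m) q))
      (by fun_prop)
  have half : ∀ r : ℝ, (1 / 2 : ℝ) • (r • (1 : 𝒜) + r • (1 : 𝒜)) = r • (1 : 𝒜) := fun r => by
    rw [← two_smul ℝ (r • (1 : 𝒜)), smul_smul]; norm_num
  -- The midpoint again lies between `m` and `M`. The upper bound there and the lower bounds at `a`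
  -- and `b` share one affine function, so they add up.
  have hmid := upper ((1 / 2 : ℝ) • (a + b))
    ((half m).symm.le.trans (smul_le_smul_of_nonneg_left (add_le_add hma hmb) (by norm_num)))
    ((smul_le_smul_of_nonneg_left (add_le_add haM hbM) (by norm_num)).trans (half M).le)
  have h2 := smul_le_smul_of_nonneg_left hmid (zero_le_two (α := ℝ))
  rw [smul_comm, smul_half_add_rpow ha0 hb0 hq0.le, smul_smul, mul_comm] at h2
  refine h2.trans (le_of_eq_of_le ?_ (add_le_add (lower a hma haM) (lower b hmb hbM)))
  module

end CStarAlgebra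

theorem theorem4p5 {H K : Type*}
    [NormedAddCommGroup H] [InnerProductSpace ℂ H] [CompleteSpace H]
    [NormedAddCommGroup K] [InnerProductSpace ℂ K] [CompleteSpace K]
    (Φ : (H →L[ℂ] H) →ₚ[ℂ] (K →L[ℂ] K)) (hΦ : Φ 1 = 1)
    (m M : ℝ) (hm : 0 < m) (hmM : m < M)
    (A B : H →L[ℂ] H)
    (hmA : m • (1 : H →L[ℂ] H) ≤ A) (hAM : A ≤ M • (1 : H →L[ℂ] H))
    (hmB : m • (1 : H →L[ℂ] H) ≤ B) (hBM : B ≤ M • (1 : H →L[ℂ] H))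
    (h : ℝ) (hh : h = M / m) (p : ℝ) (hp : 1 ≤ p) :
    ((2 : ℝ) ^ (1 - 1 / p) * (spechtRatio (h ^ (1 / p)) ^ 3)⁻¹ * kantorovichConst h (1 / p)) •
        operatorDet Φ (A + B) ^ (1 / p)
      ≤ operatorDet Φ A ^ (1 / p) + operatorDet Φ B ^ (1 / p) ∧
    operatorDet Φ A ^ (1 / p) + operatorDet Φ B ^ (1 / p)
      ≤ ((2 : ℝ) ^ (1 - 1 / p) * spechtRatio (h ^ (1 / p)) ^ 3) •
        operatorDet Φ (A + B) ^ (1 / p) := by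
  set q : ℝ := 1 / p with hqdef
  have hp0 : 0 < p := zero_lt_one.trans_le hp
  have hq0 : 0 < q := one_div_pos.2 hp0
  have hq1 : q ≤ 1 := (div_le_one hp0).2 hp
  have hM : 0 < M := hm.trans hmM
  have hA0 : 0 ≤ A := (smul_nonneg hm.le zero_le_one).trans hmA
  have hB0 : 0 ≤ B := (smul_nonneg hm.le zero_le_one).trans hmB
  -- `A + B` lies between `2 * m` and `2 * M`, so its Specht ratio is the same.
  have hdouble : (2 * M) / (2 * m) = M / m := mul_div_mul_left _ _ two_ne_zero
  have hmAB : (2 * m) • (1 : H →L[ℂ] H) ≤ A + B := by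
    rw [two_mul, add_smul]; exact add_le_add hmA hmB
  have hABM : A + B ≤ (2 * M) • (1 : H →L[ℂ] H) := by
    rw [two_mul, add_smul]; exact add_le_add hAM hBM
  have hΦs : ∀ (r : ℝ) (x : H →L[ℂ] H), Φ (r • x) = r • Φ x :=
    fun r x => Φ.map_smul_of_tower r x
  obtain ⟨hA1, hA2⟩ := map_rpow_specht_exp_map_log Φ hΦ hm hmM hq0 hmA hAM
  obtain ⟨hB1, hB2⟩ := map_rpow_specht_exp_map_log Φ hΦ hm hmM hq0 hmB hBM
  obtain ⟨hC1, hC2⟩ := map_rpow_specht_exp_map_log Φ hΦ (mul_pos two_pos hm)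
    (mul_lt_mul_of_pos_left hmM two_pos) hq0 hmAB hABM
  have hS1 : 1 ≤ spechtRatio (h ^ q) := by
    rw [hh, Real.div_rpow hM.le hm.le]
    exact one_le_spechtRatio (Real.rpow_pos_of_pos hm q) (Real.rpow_lt_rpow hm.le hmM hq0)
  have hK0 : 0 ≤ kantorovichConst h q :=
    kantorovichConst_nonneg (hh ▸ (one_lt_div hm).2 hmM) hq0 hq1
  have hK := OrderHomClass.mono Φ
    (kantorovichConst_smul_add_rpow_le hm hmM hq0 hq1 hmA hAM hmB hBM)
  have hconc := OrderHomClass.mono Φ (rpow_add_rpow_le hA0 hB0 ⟨hq0.le, hq1⟩)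
  rw [map_add, hΦs] at hK hconc
  rw [hdouble] at hC1 hC2
  rw [← hh] at hA1 hA2 hB1 hB2 hC1 hC2 hK
  change _ ≤ spechtRatio (h ^ q) • operatorDet Φ A ^ q at hA1
  change operatorDet Φ A ^ q ≤ _ at hA2
  change _ ≤ spechtRatio (h ^ q) • operatorDet Φ B ^ q at hB1
  change operatorDet Φ B ^ q ≤ _ at hB2
  change _ ≤ spechtRatio (h ^ q) • operatorDet Φ (A + B) ^ q at hC1
  change operatorDet Φ (A + B) ^ q ≤ _ at hC2
  have hD0 : 0 ≤ operatorDet Φ (A + B) ^ q := CFC.rpow_nonneg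
  generalize operatorDet Φ A ^ q = X at *
  generalize operatorDet Φ B ^ q = Y at *
  generalize operatorDet Φ (A + B) ^ q = Z at *
  generalize spechtRatio (h ^ q) = S at *
  generalize kantorovichConst h q = k at *
  have hS0 : 0 < S := zero_lt_one.trans_le hS1
  set c : ℝ := 2 ^ (1 - q) with hc
  have hc0 : 0 ≤ c := Real.rpow_nonneg two_pos.le _
  constructor
  · have hSS : (S ^ 3)⁻¹ ≤ S⁻¹ * S⁻¹ := by
      rw [← mul_inv, ← sq]
      exact inv_anti₀ (by positivity) (pow_le_pow_right₀ hS1 (by norm_num))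
    calc (c * (S ^ 3)⁻¹ * k) • Z ≤ (c * (S⁻¹ * S⁻¹) * k) • Z :=
          smul_le_smul_of_nonneg_right (by gcongr) hD0
      _ = (S⁻¹ * S⁻¹ * (c * k)) • Z := by congr 1; ring
      _ ≤ (S⁻¹ * S⁻¹ * (c * k)) • (S • Φ ((A + B) ^ q)) :=
          smul_le_smul_of_nonneg_left hC2 (by positivity)
      _ = S⁻¹ • ((c * k) • Φ ((A + B) ^ q)) := by
          rw [smul_smul, smul_smul]; congr 1; field_simp
      _ ≤ S⁻¹ • (S • X + S • Y) :=
          smul_le_smul_of_nonneg_left (hK.trans (add_le_add hA1 hB1)) (by positivity)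
      _ = X + Y := by rw [← smul_add, smul_smul, inv_mul_cancel₀ hS0.ne', one_smul]
  · calc X + Y ≤ S • Φ (A ^ q) + S • Φ (B ^ q) := add_le_add hA2 hB2
      _ = S • (Φ (A ^ q) + Φ (B ^ q)) := (smul_add _ _ _).symm
      _ ≤ S • (c • Φ ((A + B) ^ q)) := smul_le_smul_of_nonneg_left hconc hS0.le
      _ = (c * S) • Φ ((A + B) ^ q) := by rw [smul_smul, mul_comm]
      _ ≤ (c * S) • (S • Z) := smul_le_smul_of_nonneg_left hC1 (by positivity)
      _ = (c * S ^ 2) • Z := by rw [smul_smul]; congr 1; ring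
      _ ≤ (c * S ^ 3) • Z := smul_le_smul_of_nonneg_right
          (mul_le_mul_of_nonneg_left (pow_le_pow_right₀ hS1 (by norm_num)) hc0) hD0
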